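/- \textbf{Queries.} A (full conjunctive) query $Q=R_1(\mathbf x_1)\bowtie\cdots\bowtie R_n(\mathbf x_n)$ is a finite family of atoms; each atom $R$ has a finite set of variables $\Sigma(R)$, its schema. An instance $D$ gives each atom a finite set of tuples over its schema. Write $|\mathsf{IN}|$ for the total number of input tuples and $|\mathsf{OUT}|$ for the number of tuples in the result of $Q$. A plan is a permutation of the atoms of $Q$. For a list $L$ of atoms and $R\in L$, $\mathsf{keys}(L,R)$ is the set of variables that $R$ shares with the other atoms of $L$. \textbf{Tree convolutions.} A \emph{tree convolution} $\mathscr T$ of $Q$ is a rooted tree each node of which is an atom of $Q$ or, recursively, a tree convolution of a subset of the atoms of $Q$, such that every atom of $Q$ appears exactly once anywhere in $\mathscr T$, and every tree in $\mathscr T$ is a join tree (for each variable, the nodes containing it are connected) after each non-atom node is replaced with a fresh atom over all variables occurring in that node. It is \emph{rooted} if nested convolutions appear only at the root of each tree; it then consists of nested trees $T_1,\dots,T_m$, where $T_1$ is the innermost tree, $T_m$ is the outermost, and $T_{i-1}$ is the root node of $T_i$. Let $S_i$ be the join of all relations that occur in $T_i$ (at any nesting depth). \textbf{Plans.} A plan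 is \emph{generated} by a rooted convolution if it is obtained inside-out: for $i=1,\dots,m$ in turn, append the nodes of $T_i$ (for $i>1$ without the root node $T_{i-1}$, whose atoms are already listed) in the reverse of a GYO reduction order of $T_i$ that ends in the root. Here a GYO reduction order of a rooted join tree lists all its nodes so that, for every node $R$ but the last, the parent node $P$ of $R$ comes later and $\mathsf{keys}(L,R)\subseteq\Sigma(P)$, where $L$ consists of $R$ and the nodes after it. \textbf{Algorithm.} The \emph{parent} of an atom $R$ is its parent node in the tree of $\mathscr T$ of which it is a node, if that is an atom; if the parent node is a nested tree, it is the relation of that nested tree that comes last in the plan; the root of $T_1$ has no parent. Given a plan $p$, TTJ first builds for each atom $R=p[i]$ a hash table keyed on $\mathsf{keys}(p[1..i],R)$ and then calls $\mathrm{ttj}((),p,1)$. The call $\mathrm{ttj}(t,p,i)$ outputs $t$ if $i>|p|$. Otherwise let $R=p[i]$ and $k=\pi_{\mathsf{keys}(p[1..i],R)}(t)$. If the bucket $R[k]$ is empty and $R$ has a parent $P$, the call returns a backjump to $P$. Else, for each $r\in R[k]$, it calls $\mathrm{ttj}(t\mathbin{+\!\!+}r,p,i+1)$; if that returns a backjump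 to $R$, then $r$ is deleted from $R[k]$, except that nothing is deleted if the backjump came from an atom whose parent node is a nested tree, and the loop goes on; if it returns a backjump to another relation, the call returns that backjump at once. One step is charged for every call with its hash lookup, every output, every loop iteration, and every insertion into or deletion from a hash table. \textbf{Theorem.} Let $\mathscr T$ be a rooted tree convolution of a (possibly cyclic) query $Q$. There is a plan $p$ for $Q$, generated by $\mathscr T$, such that TTJ with the parent function of $\mathscr T$ runs on $p$ in time $O\bigl(|\mathsf{IN}|+|\mathsf{OUT}|+\sum_{i=1}^m|S_i|\bigr)$; that is, there is a constant $C$, depending only on $Q$, $\mathscr T$ and $p$, such that on every instance $D$ the number of steps is at most $C\,\bigl(1+|\mathsf{IN}|+|\mathsf{OUT}|+\sum_{i=1}^m|S_i|\bigr)$. -/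

import Mathlib

universe u v w

noncomputable section

namespace TTJ

/-! ## Queries, tuples, databases -/

/-- A full conjunctive (natural join) query: its atoms are indexed by the type `ι` (finite in all
uses), and each atom has a finite set of variables, its schema. -/
structure Query (ι : Type u) (V : Type v) where
  schema : ι → Finset V

/-- A tuple: a partial assignment of values in `α` to variables.  Its schema is the set of variables
at which it is defined. -/
abbrev Tup (V : Type v) (α : Type w) := V → Option α

/-- The empty tuple `()`. -/
def emptyTup {V : Type v} {α : Type w} : Tup V α := fun _ => none

/-- Projection of a tuple onto a set of variables. -/
def proj {V : Type v} [DecidableEq V] {α : Type w} (s : Finset V) (t : Tup V α) : Tup V α :=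
  fun x => if x ∈ s then t x else none

/-- Concatenation of tuples (they agree on common variables whenever the algorithm uses it). -/
def concat {V : Type v} {α : Type w} (t r : Tup V α) : Tup V α := fun x => t x <|> r x

/-- A database instance: a finite relation for each atom, under set semantics.  A relation is stored
as a duplicate-free list (in an arbitrary order) of tuples over the schema of the atom. -/
structure Database {ι : Type u} {V : Type v} (Q : Query ι V) (α : Type w) where
  rel : ι → List (Tup V α)
  nodup : ∀ a, (rel a).Nodup
  dom : ∀ a, ∀ r ∈ rel a, ∀ x, (r x).isSome ↔ x ∈ Q.schema a

section Sizes

variable {ι : Type u} {V : Type v} [DecidableEq V] {Q : Query ι V} {α : Type w}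

/-- The natural join of the relations of the atoms in `S`. -/
def Database.join (D : Database Q α) (S : Set ι) : Set (Tup V α) :=
  {t | (∀ x, (t x).isSome ↔ ∃ a ∈ S, x ∈ Q.schema a) ∧ ∀ a ∈ S, proj (Q.schema a) t ∈ D.rel a}

/-- Joins are finite, so that `Set.ncard` measures their size. -/
theorem Database.join_finite [Finite ι] (D : Database Q α) (S : Set ι) : (D.join S).Finite := by
  have hfin : (Set.pi Set.univ fun a : S => {r | r ∈ D.rel a}).Finite :=
    Set.Finite.pi fun a => List.finite_toSet _
  refine Set.Finite.of_finite_image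
    (f := fun t (a : S) => proj (Q.schema a) t) (hfin.subset ?_) ?_
  · rintro _ ⟨t, ht, rfl⟩ a _
    exact ht.2 a a.2
  · intro t ht t' ht' h
    funext x
    by_cases hx : ∃ a ∈ S, x ∈ Q.schema a
    · obtain ⟨a, ha, hxa⟩ := hx
      have := congrFun (congrFun h ⟨a, ha⟩) x
      simpa [proj, hxa] using this
    · have h1 := mt (ht.1 x).1 hx
      have h2 := mt (ht'.1 x).1 hx
      simp only [Option.isSome_iff_ne_none, not_not] at h1 h2
      rw [h1, h2]

/-- `|IN|`: the total number of input tuples. -/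
def Database.inputSize [Fintype ι] (D : Database Q α) : ℕ := ∑ a, (D.rel a).length

/-- `|OUT|`: the number of tuples in the result of the query. -/
def Database.outputSize (D : Database Q α) : ℕ := (D.join Set.univ).ncard

end Sizes

/-! ## Keys, ears, join trees and GYO reduction orders

`β` is a type of atoms with schemas `sch`; a (sub)query is a list of distinct atoms. -/

section Acyclic

variable {β : Type u} {V : Type v} [DecidableEq β] [DecidableEq V]

/-- The key schema of `R` in `L`: the variables `R` shares with the other atoms of `L`. -/
def keys (sch : β → Finset V) (L : List β) (R : β) : Finset V :=
  sch R ∩ (L.toFinset.erase R).biUnion sch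

/-- `P` is a parent of `R` in `L`: another atom of `L` that contains the key schema of `R`.
`R` is an ear of `L` when it has a parent in `L`. -/
def IsParent (sch : β → Finset V) (L : List β) (R P : β) : Prop :=
  P ∈ L ∧ P ≠ R ∧ keys sch L R ⊆ sch P

/-- A join tree: a tree on the atoms in which, for each variable, the nodes containing it are
connected. -/
def IsJoinTree (G : SimpleGraph β) (sch : β → Finset V) : Prop :=
  G.IsTree ∧ ∀ x, (G.induce {b | x ∈ sch b}).Preconnected

/-- In the tree `G` rooted at `root`, the node `P` is the parent node of `R`. -/
def IsTreeParent (G : SimpleGraph β) (root P R : β) : Prop :=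
  G.Adj P R ∧ G.dist root R = G.dist root P + 1

/-- `L` is a GYO reduction order of (the nodes of) the join tree `G` rooted at `root`: it lists all
the atoms, each once, and every atom but the last is an ear of the subquery formed by itself and the
atoms after it, a parent of it there being its parent node in `G`. -/
def IsGYOOrder (G : SimpleGraph β) (root : β) (sch : β → Finset V) (L : List β) : Prop :=
  L.Nodup ∧ (∀ b, b ∈ L) ∧
    ∀ R L', (R :: L') <:+ L → L' ≠ [] →
      ∃ P, IsTreeParent G root P R ∧ IsParent sch (R :: L') R P

end Acyclic

/-! ## Tree convolutions -/

/-- Nested trees over a set of atoms: an atom, or a rooted tree each node of which is an atom or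
again a nested tree. -/
inductive NestedTree (ι : Type u) : Type u
  | atom (a : ι) : NestedTree ι
  | tree (n : ℕ) (G : SimpleGraph (Fin n)) (root : Fin n) (node : Fin n → NestedTree ι) :
      NestedTree ι

namespace NestedTree

variable {ι : Type u} {V : Type v}

/-- All atoms that occur anywhere in a nested tree, with multiplicity. -/
def atoms : NestedTree ι → Multiset ι
  | atom a => {a}
  | tree _ _ _ node => ∑ i, (node i).atoms

/-- All variables of a nested tree. -/
def vars [DecidableEq V] (Q : Query ι V) : NestedTree ι → Finset V
  | atom a => Q.schema a
  | tree _ _ _ node => Finset.univ.biUnion fun i => (node i).vars Q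

/-- A proper tree, each node of which is an atom or recursively such a tree, and which is a join
tree once each nested node is replaced with a fresh atom over all variables of that node. -/
def IsNestedJoinTree [DecidableEq V] (Q : Query ι V) : NestedTree ι → Prop
  | atom _ => False
  | tree _ G _ node =>
      IsJoinTree G (fun i => (node i).vars Q) ∧
        ∀ i, (∃ a, node i = atom a) ∨ (node i).IsNestedJoinTree Q

/-- A tree convolution of `Q`: moreover each atom of `Q` appears exactly once in it. -/
def IsTreeConvolution [Fintype ι] [DecidableEq V] (Q : Query ι V) (T : NestedTree ι) : Prop :=
  T.IsNestedJoinTree Q ∧ T.atoms = (Finset.univ : Finset ι).val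

/-- Nested trees appear only at the root of each tree. -/
def IsRooted : NestedTree ι → Prop
  | atom _ => True
  | tree _ _ root node => (∀ i, i ≠ root → ∃ a, node i = atom a) ∧ (node root).IsRooted

/-- The plans generated by a rooted convolution, inside-out: first a plan for the root node, then
the other nodes of the tree (all of them atoms), in the reverse of a GYO reduction order of the
tree. -/
def GeneratesPlan [DecidableEq V] (Q : Query ι V) : NestedTree ι → List ι → Prop
  | atom a, p => p = [a]
  | tree n G root node, p =>
      ∃ (q s : List ι) (o : List (Fin n)),
        (node root).GeneratesPlan Q q ∧
        o.map node = s.map atom ∧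
        IsGYOOrder G root (fun i => (node i).vars Q) (root :: o).reverse ∧
        p = q ++ s

/-- `N` is the parent node of the atom `R` in the tree (anywhere in the nested tree) of which `R` is
a node. -/
def IsParentNode : NestedTree ι → ι → NestedTree ι → Prop
  | atom _, _, _ => False
  | tree _ G root node, R, N =>
      (∃ i j, node i = atom R ∧ IsTreeParent G root j i ∧ N = node j) ∨
        ∃ i, (node i).IsParentNode R N

open Classical in
/-- The modified parent function for a convolution `T` and a plan `p`.  If the parent node of `R` is
an atom `P`, then the parent is `P`, and a backjump to it deletes a tuple (flag `true`).  If it is a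
nested tree, then the parent is the relation of that tree that comes last in the plan, and a backjump
to it deletes nothing (flag `false`). -/
def parent (T : NestedTree ι) (p : List ι) (R : ι) : Option (ι × Bool) :=
  if h : ∃ N, T.IsParentNode R N then
    match h.choose with
    | atom P => some (P, true)
    | N@(tree _ _ _ _) => (p.filter (fun a => a ∈ N.atoms)).getLast?.map (fun P => (P, false))
  else none

/-- `∑ᵢ |Sᵢ|`: the sum, over all trees of the convolution (nested ones and the outermost one), of the
size of the join of all relations that occur anywhere in the tree. -/
def joinSizes [DecidableEq V] {Q : Query ι V} {α : Type w} (D : Database Q α) : NestedTree ι → ℕ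
  | atom _ => 0
  | T@(tree _ _ _ node) => (D.join {a | a ∈ T.atoms}).ncard + ∑ i, (node i).joinSizes D

end NestedTree

/-- A (left-deep linear) query plan: a permutation of the atoms. -/
def IsPlan {ι : Type u} (p : List ι) : Prop := p.Nodup ∧ ∀ a, a ∈ p

/-! ## TreeTracker Join, with a step count

One step is charged for every call (including its hash lookup), every output, every loop iteration,
every deletion from a hash table, and every insertion into one when the tables are built.  Work on
schemas, keys and parents depends on the query only and is free. -/

/-- The state of the machine: for each atom a hash table, from keys to buckets of tuples; the tuples
output so far; and the number of steps made so far. -/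
structure State (ι : Type u) (V : Type v) (α : Type w) where
  tables : ι → Tup V α → List (Tup V α)
  output : List (Tup V α)
  steps : ℕ

section Algorithm

variable {ι : Type u} [DecidableEq ι] {V : Type v} [DecidableEq V] {α : Type w}

namespace State

/-- Charge one step. -/
def tick (σ : State ι V α) : State ι V α := { σ with steps := σ.steps + 1 }

/-- Output a tuple. -/
def emit (t : Tup V α) (σ : State ι V α) : State ι V α :=
  { σ with output := t :: σ.output, steps := σ.steps + 1 }

open Classical in
/-- Replace the bucket of key `k` in the hash table of `R` with `b`. -/
def setBucket (R : ι) (k : Tup V α) (b : List (Tup V α)) (σ : State ι V α) : State ι V α :=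
  { σ with
    tables := Function.update σ.tables R (Function.update (σ.tables R) k b)
    steps := σ.steps + 1 }

/-- Insert the tuple `r` into the bucket `R[k]`. -/
def insert (R : ι) (k r : Tup V α) (σ : State ι V α) : State ι V α :=
  σ.setBucket R k (r :: σ.tables R k)

open Classical in
/-- Delete the tuple `r` from the bucket `R[k]`. -/
def delete (R : ι) (k r : Tup V α) (σ : State ι V α) : State ι V α :=
  σ.setBucket R k ((σ.tables R k).erase r)

end State

/-- Build the hash tables of the atoms `rest` of a plan, where `pre` are the atoms before them.  The
table of an atom is keyed on the variables it shares with the atoms before it. -/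
def buildTables {Q : Query ι V} (D : Database Q α) :
    List ι → List ι → State ι V α → State ι V α
  | _, [], σ => σ
  | pre, R :: rest, σ =>
      buildTables D (pre ++ [R]) rest
        ((D.rel R).foldl (fun σ r => σ.insert R (proj (keys Q.schema (pre ++ [R]) R) r) r) σ)

/-- The loop `for r in R[k]`, with the recursive call as `body`.  A result `some (P, d)` of the body
is a backjump to `P`: it is caught here if `P = R`, where the current tuple is deleted if the flag
`d` is set, and it is passed on otherwise. -/
def loop (R : ι) (k : Tup V α)
    (body : Tup V α → State ι V α → Option (ι × Bool) × State ι V α) :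
    List (Tup V α) → State ι V α → Option (ι × Bool) × State ι V α
  | [], σ => (none, σ)
  | r :: rs, σ =>
      match body r σ.tick with
      | (none, σ') => loop R k body rs σ'
      | (some (P, d), σ') =>
          if P = R then loop R k body rs (if d then σ'.delete R k r else σ')
          else (some (P, d), σ')

/-- The call `ttj(t, plan, i)`, where `pre` are the first `i - 1` atoms of the plan and the next
argument is the list of the other ones; `par` is the parent function. -/
def ttj (Q : Query ι V) (par : ι → Option (ι × Bool)) :
    List ι → List ι → Tup V α → State ι V α → Option (ι × Bool) × State ι V α
  | _, [], t, σ => (none, σ.emit t)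
  | pre, R :: rest, t, σ =>
      let k := proj (keys Q.schema (pre ++ [R]) R) t
      match σ.tables R k, par R with
      | [], some P => (some P, σ.tick)
      | bucket, _ =>
          loop R k (fun r σ' => ttj Q par (pre ++ [R]) rest (concat t r) σ') bucket σ.tick

/-- The whole run of TTJ with parent function `par` on the plan `p`: build the hash tables, then call
`ttj((), p, 1)`.  Its value is the final state. -/
def run {Q : Query ι V} (D : Database Q α) (par : ι → Option (ι × Bool)) (p : List ι) :
    State ι V α :=
  (ttj Q par [] p emptyTup
    (buildTables D [] p { tables := fun _ _ => [], output := [], steps := 0 })).2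

end Algorithm

end TTJ

end

/-! The bound is an amortized count. Every call of TTJ, except one at an atom without a parent,
makes progress: somewhere inside it a tuple is output, a tuple is deleted, or a backjump is caught
without deletion, or else the call itself returns a backjump. The work at one level of the recursion
is charged to the progress made below it. The recursion has depth `p.length`, so each unit of
progress is charged O(`p.length`) times. A returned backjump acts as a token that is passed up until
it is caught, where a deletion or a non-deleting iteration redeems it; at most one token survives
the run.

It remains to count progress. Deletions number at most |IN|. Outputs, and iterations at atoms in `F`
(the targets of non-deleting backjumps), are overcounted by `extensionCount`, which ignores
deletions. At a fixed position of the plan the partial tuples are distinct elements of the join of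
that prefix (`sum_extensionCount_le`). For outputs the prefix is the whole plan, which gives |OUT|;
for an atom in `F` it consists of exactly the atoms of a nested tree, which gives some |S_i|
(`GeneratesPlan.ncard_join_le`).

Only the number of steps is at stake, so the argument never needs deleted tuples to be dangling. The
convolution enters through that prefix property, through `GeneratesPlan.parent_ne_none`, and through
the existence of a generated plan: listing the nodes of each tree by increasing depth yields a
reversed GYO order (`exists_isGYOOrder`). The accounting itself is `loop_isPaidFor` and
`ttj_isPaidFor`. -/

namespace TTJ

/-! ### Parents in rooted trees, and GYO orders by depth -/

section Trees

variable {β : Type*} {G : SimpleGraph β} {root : β}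

theorem exists_isTreeParent (hG : G.Connected) {R : β} (h : R ≠ root) :
    ∃ P, IsTreeParent G root P R := by
  obtain ⟨w, hw⟩ := hG.exists_walk_length_eq_dist root R
  have hnil : ¬ w.Nil := SimpleGraph.Walk.not_nil_of_ne h.symm
  refine ⟨w.penultimate, w.adj_penultimate hnil, ?_⟩
  have h1 : w.dropLast.length + 1 = w.length := by
    rw [← SimpleGraph.Walk.length_concat _ (w.adj_penultimate hnil),
      SimpleGraph.Walk.concat_dropLast]
  have h2 := SimpleGraph.dist_le w.dropLast
  have h3 := hG.dist_triangle (u := root) (v := w.penultimate) (w := R)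
  have h4 := SimpleGraph.dist_eq_one_iff_adj.2 (w.adj_penultimate hnil)
  omega

/-- A shortest walk from the root to a parent, extended by the edge to `R`, is again shortest, hence
a path; a tree has only one path from the root to `R`. -/
theorem IsTreeParent.unique (hG : G.IsTree) {R P P' : β} (h : IsTreeParent G root P R)
    (h' : IsTreeParent G root P' R) : P = P' := by
  obtain ⟨w, hw⟩ := hG.connected.exists_walk_length_eq_dist root P
  obtain ⟨w', hw'⟩ := hG.connected.exists_walk_length_eq_dist root P'
  have hp : (w.concat h.1).IsPath :=
    SimpleGraph.Walk.isPath_of_length_eq_dist _ (by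
      rw [SimpleGraph.Walk.length_concat, hw, h.2])
  have hp' : (w'.concat h'.1).IsPath :=
    SimpleGraph.Walk.isPath_of_length_eq_dist _ (by
      rw [SimpleGraph.Walk.length_concat, hw', h'.2])
  have heq := (hG.existsUnique_path root R).unique hp hp'
  have := congrArg SimpleGraph.Walk.penultimate heq
  simpa using this

/-- A connected set of nodes of a rooted tree that contains `R` and another node not deeper than
`R` contains the parent of `R`. -/
theorem IsTreeParent.mem_of_preconnected (hG : G.IsTree) {S : Set β}
    (hS : (G.induce S).Preconnected) {R B P : β} (hR : R ∈ S) (hB : B ∈ S) (hne : B ≠ R)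
    (hle : G.dist root B ≤ G.dist root R) (hP : IsTreeParent G root P R) : P ∈ S := by
  by_contra hPS
  -- If `P` is not in `S`, a walk inside `S` from `R` can never climb above `R`: all of `S` lies in
  -- the subtree below `R`, so `B` would be strictly deeper than `R`.
  have key : ∀ v : S, Relation.ReflTransGen (G.induce S).Adj ⟨R, hR⟩ v →
      G.dist root v = G.dist root R + G.dist R v := by
    intro v hv
    induction hv with
    | refl => simp
    | @tail v w _ hadj ih =>
      have hvw : G.Adj v w := hadj
      have hRw := hG.connected.dist_triangle (u := R) (v := (v : β)) (w := (w : β))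
      have hrw := hG.connected.dist_triangle (u := root) (v := R) (w := (w : β))
      rw [SimpleGraph.dist_eq_one_iff_adj.2 hvw] at hRw
      rcases hG.dist_eq_dist_add_one_of_adj root hvw with hd | hd
      · have hw : IsTreeParent G root w v := ⟨hvw.symm, hd⟩
        by_cases hvR : (v : β) = R
        · rw [hvR] at hw
          exact absurd (hw.unique hG hP ▸ w.2) hPS
        -- The neighbour of `v` towards `R` is also its parent with respect to `root`, so the upward
        -- step to `w` stays below `R`.
        · obtain ⟨w', hw'⟩ := exists_isTreeParent (root := R) hG.connected hvR
          have h1 := hG.connected.dist_triangle (u := root) (v := R) (w := w')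
          have h2 := hG.connected.dist_triangle (u := root) (v := w') (w := (v : β))
          rw [SimpleGraph.dist_eq_one_iff_adj.2 hw'.1] at h2
          have h3 := hw'.2
          have hw'' : IsTreeParent G root w' v := ⟨hw'.1, by omega⟩
          have := hw''.unique hG hw
          subst this
          omega
      · omega
  have h1 := key ⟨B, hB⟩ ((SimpleGraph.reachable_iff_reflTransGen _ _).1 (hS _ _))
  have h2 := hG.connected.pos_dist_of_ne hne.symm
  simp only at h1
  omega

end Trees

/-- Every rooted join tree has a GYO reduction order that ends in the root. -/
theorem exists_isGYOOrder {V : Type*} [DecidableEq V] {n : ℕ} {G : SimpleGraph (Fin n)}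
    (root : Fin n) {sch : Fin n → Finset V} (hG : IsJoinTree G sch) :
    ∃ o : List (Fin n), IsGYOOrder G root sch (root :: o).reverse := by
  classical
  -- Sorting by depth puts parents first; after reversal no later node is deeper than `R`, which is
  -- what `IsTreeParent.mem_of_preconnected` needs.
  let r : Fin n → Fin n → Prop := fun a b => G.dist root a ≤ G.dist root b
  have : Std.Total r := ⟨fun a b => le_total _ _⟩
  have : IsTrans (Fin n) r := ⟨fun a b c => le_trans⟩
  let l := ((Finset.univ : Finset (Fin n)).erase root).toList
  have hperm : (l.insertionSort r).Perm l := List.perm_insertionSort r l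
  have hmem : ∀ b, b ∈ l.insertionSort r ↔ b ≠ root := by
    intro b
    rw [hperm.mem_iff]
    simp [l]
  have hnd : (root :: l.insertionSort r).Nodup :=
    List.nodup_cons.2 ⟨by simp [hmem], hperm.nodup_iff.2 (Finset.nodup_toList _)⟩
  have hall : ∀ b, b ∈ (root :: l.insertionSort r).reverse := by
    intro b
    by_cases h : b = root <;> simp [h, hmem]
  have hsorted : (root :: l.insertionSort r).reverse.Pairwise
      (fun a b => G.dist root b ≤ G.dist root a) := by
    rw [List.pairwise_reverse]
    exact List.pairwise_cons.2 ⟨by simp, List.pairwise_insertionSort r l⟩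
  refine ⟨l.insertionSort r, List.nodup_reverse.2 hnd, hall, ?_⟩
  have hnd' := List.nodup_reverse.2 hnd
  generalize (root :: l.insertionSort r).reverse = L at hall hsorted hnd'
  rintro R L' ⟨pre, rfl⟩ hL'
  have hdist : ∀ b ∈ L', G.dist root b ≤ G.dist root R :=
    (List.pairwise_cons.1 (List.pairwise_append.1 hsorted).2.1).1
  have hRL' : R ∉ L' := (List.nodup_cons.1 (List.nodup_append.1 hnd').2.1).1
  have hRroot : R ≠ root := by
    rintro rfl
    obtain ⟨b, hb⟩ := List.exists_mem_of_ne_nil _ hL'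
    have := hdist b hb
    rw [SimpleGraph.dist_self, Nat.le_zero, hG.1.connected.dist_eq_zero_iff] at this
    exact hRL' (this ▸ hb)
  obtain ⟨P, hP⟩ := exists_isTreeParent hG.1.connected hRroot
  refine ⟨P, hP, ?_, fun h => hP.1.ne h, ?_⟩
  · rcases List.mem_append.1 (hall P) with h | h
    · have h1 := (List.pairwise_append.1 hsorted).2.2 P h R (by simp)
      have h2 := hP.2
      omega
    · exact h
  · intro x hx
    simp only [keys, Finset.mem_inter, Finset.mem_biUnion, Finset.mem_erase,
      List.mem_toFinset] at hx
    obtain ⟨hxR, B, ⟨hBR, hB⟩, hxB⟩ := hx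
    have hB' : B ∈ L' := by simpa [hBR] using hB
    exact hP.mem_of_preconnected hG.1 (hG.2 x) hxR hxB hBR (hdist B hB')

/-! ### Generated plans and the modified parent function -/

namespace NestedTree

variable {ι : Type*} {V : Type*} [DecidableEq V] {Q : Query ι V}

theorem IsNestedJoinTree.exists_generatesPlan :
    ∀ {T : NestedTree ι}, (∃ a, T = atom a) ∨ T.IsNestedJoinTree Q → T.IsRooted →
      ∃ p, T.GeneratesPlan Q p
  | atom a, _, _ => ⟨[a], rfl⟩
  | tree n G root node, h, hr => by
      rcases h with ⟨a, ha⟩ | h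
      · cases ha
      obtain ⟨q, hq⟩ := exists_generatesPlan (h.2 root) hr.2
      obtain ⟨o, ho⟩ := exists_isGYOOrder root h.1
      have hnd := List.nodup_cons.1 (List.nodup_reverse.1 ho.1)
      have hs : ∃ s : List ι, s.map atom = o.map node := by
        have : o.map node ∈ Set.range (List.map (atom (ι := ι))) := by
          rw [Set.range_list_map]
          simp only [Set.mem_ofPred_eq, List.mem_map]
          rintro _ ⟨i, hi, rfl⟩
          obtain ⟨a, ha⟩ := hr.1 i (fun h => hnd.1 (h ▸ hi))
          exact ⟨a, ha.symm⟩
        exact this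
      obtain ⟨s, hs⟩ := hs
      exact ⟨q ++ s, q, s, o, hq, hs.symm, ho, rfl⟩

theorem GeneratesPlan.ne_nil :
    ∀ {T : NestedTree ι} {p : List ι}, T.GeneratesPlan Q p → p ≠ []
  | atom a, p, h => by
      have : p = [a] := h
      simp [this]
  | tree n G root node, p, h => by
      obtain ⟨q, s, o, hq, -, -, rfl⟩ := h
      simp [hq.ne_nil]

/-- A generated plan lists the atoms of the nested tree. -/
theorem GeneratesPlan.coe_eq_atoms :
    ∀ {T : NestedTree ι} {p : List ι}, T.GeneratesPlan Q p → (p : Multiset ι) = T.atoms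
  | atom a, p, h => by
      have : p = [a] := h
      simp [this, atoms]
  | tree n G root node, p, h => by
      obtain ⟨q, s, o, hq, hs, ho, rfl⟩ := h
      have hnd := List.nodup_reverse.1 ho.1
      have huniv : (Finset.univ : Finset (Fin n)) = (root :: o).toFinset := by
        ext i
        simpa [or_comm] using ho.2.1 i
      have hsum : (s : Multiset ι) = (o.map fun i => (node i).atoms).sum := by
        have h1 : (o.map fun i => (node i).atoms) = s.map fun a => ({a} : Multiset ι) := by
          have := congrArg (List.map (atoms (ι := ι))) hs
          simpa [List.map_map, Function.comp_def, atoms] using this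
        rw [h1]
        clear hs h1
        induction s with
        | nil => rfl
        | cons a s ih => simp [← ih]
      rw [atoms, huniv, List.sum_toFinset _ hnd, List.map_cons, List.sum_cons, ← hsum,
        ← hq.coe_eq_atoms, Multiset.coe_add]

/-- The subtree that is the parent node of an atom is either an atom, or it is a nested tree whose
atoms form an initial segment of the plan. -/
theorem IsParentNode.exists_prefix {α : Type*} (D : Database Q α) :
    ∀ {T : NestedTree ι} {p : List ι}, T.IsRooted → T.GeneratesPlan Q p →
      ∀ {R : ι} {N : NestedTree ι}, T.IsParentNode R N → (∃ a, N = atom a) ∨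
        ∃ q s, p = q ++ s ∧ q ≠ [] ∧ (q : Multiset ι) = N.atoms ∧ N.joinSizes D ≤ T.joinSizes D
  | atom a, p, _, _, R, N, h => h.elim
  | tree n G root node, p, hr, hp, R, N, h => by
      obtain ⟨q, s, o, hq, hs, ho, rfl⟩ := hp
      have hle : (node root).joinSizes D ≤ (tree n G root node).joinSizes D := by
        rw [joinSizes]
        exact (Finset.single_le_sum (f := fun i => (node i).joinSizes D)
          (fun _ _ => Nat.zero_le _) (Finset.mem_univ root)).trans (Nat.le_add_left _ _)
      rcases h with ⟨i, j, -, -, rfl⟩ | ⟨i, hi⟩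
      · by_cases hj : j = root
        · subst hj
          exact Or.inr ⟨q, s, rfl, hq.ne_nil, hq.coe_eq_atoms, hle⟩
        · exact Or.inl (hr.1 j hj)
      · by_cases hir : i = root
        · subst hir
          rcases IsParentNode.exists_prefix D hr.2 hq hi with h | ⟨q', s', rfl, h1, h2, h3⟩
          · exact Or.inl h
          · exact Or.inr ⟨q', s' ++ s, by simp, h1, h2, h3.trans hle⟩
        · obtain ⟨a, ha⟩ := hr.1 i hir
          rw [ha] at hi
          exact hi.elim

theorem GeneratesPlan.exists_isParentNode :
    ∀ {T : NestedTree ι} {p : List ι}, (∃ a, T = atom a) ∨ T.IsNestedJoinTree Q →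
      T.GeneratesPlan Q p → ∀ {R : ι}, R ∈ p.tail → ∃ N, T.IsParentNode R N
  | atom a, p, _, h, R, hR => by
      have : p = [a] := h
      simp [this] at hR
  | tree n G root node, p, hT, h, R, hR => by
      rcases hT with ⟨a, ha⟩ | hT
      · cases ha
      obtain ⟨q, s, o, hq, hs, ho, rfl⟩ := h
      rw [List.tail_append_of_ne_nil hq.ne_nil, List.mem_append] at hR
      rcases hR with hR | hR
      · obtain ⟨N, hN⟩ := exists_isParentNode (hT.2 root) hq hR
        exact ⟨N, Or.inr ⟨root, hN⟩⟩
      · have h1 : atom R ∈ o.map node := hs ▸ List.mem_map_of_mem hR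
        obtain ⟨i, hi, hiR⟩ := List.mem_map.1 h1
        have hir : i ≠ root := fun h =>
          (List.nodup_cons.1 (List.nodup_reverse.1 ho.1)).1 (h ▸ hi)
        obtain ⟨j, hj⟩ := exists_isTreeParent hT.1.1.connected hir
        exact ⟨node j, Or.inl ⟨i, j, hiR, hj, rfl⟩⟩

/-- `parent` picks a parent node by choice. This describes its value for whichever node was picked,
so uniqueness of parent nodes plays no role. In the nested case, filtering the plan by the atoms of
the node returns the prefix `q`. -/
theorem parent_cases {T : NestedTree ι} {p : List ι} {R : ι} (h : ∃ N, T.IsParentNode R N) :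
    ∃ N, T.IsParentNode R N ∧ ((∃ P, N = atom P ∧ T.parent p R = some (P, true)) ∨
      ((∀ a, N ≠ atom a) ∧ ∀ q s, p = q ++ s → p.Nodup → (q : Multiset ι) = N.atoms →
        T.parent p R = q.getLast?.map fun P => (P, false))) := by
  classical
  refine ⟨h.choose, h.choose_spec, ?_⟩
  unfold parent
  rw [dif_pos h]
  generalize h.choose = N
  cases N with
  | atom P => exact Or.inl ⟨P, rfl, rfl⟩
  | tree n G root node =>
    refine Or.inr ⟨by simp, ?_⟩
    intro q s hp hnd hq
    have hfilter : (q ++ s).filter (fun a => a ∈ (q : Multiset ι)) = q := by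
      rw [hp] at hnd
      have hdisj := (List.nodup_append.1 hnd).2.2
      rw [List.filter_append, List.filter_eq_self.2 (by simp), List.filter_eq_nil_iff.2,
        List.append_nil]
      intro a ha
      simpa using fun haq => hdisj a haq a ha rfl
    subst hp
    simp only [← hq]
    congr 2

/-- Ensures that an empty bucket at any atom but the first results in a backjump, so that the call
is paid for. -/
theorem GeneratesPlan.parent_ne_none {T : NestedTree ι} {p : List ι}
    (hT : T.IsNestedJoinTree Q) (hr : T.IsRooted) (hp : T.GeneratesPlan Q p) (hnd : p.Nodup)
    {R : ι} (hR : R ∈ p.tail) : T.parent p R ≠ none := by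
  obtain ⟨N, hN, ⟨P, -, h⟩ | ⟨hna, h⟩⟩ :=
    parent_cases (p := p) (hp.exists_isParentNode (.inr hT) hR)
  · simp [h]
  -- A dummy instance: `exists_prefix` refers to one only in its size bound, which is discarded
  -- here.
  · let D : Database Q Unit := ⟨fun _ => [], by simp, by simp⟩
    obtain ⟨a, ha⟩ | ⟨q, s, h1, h2, h3, -⟩ := hN.exists_prefix D hr hp
    · exact absurd ha (hna a)
    · rw [h q s h1 hnd h3]
      simpa using h2

/-- If backjumps to `P` do not delete, then the join of the initial segment of the plan that ends in
`P` is one of the joins counted in `joinSizes`. -/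
theorem GeneratesPlan.ncard_join_le {α : Type*} (D : Database Q α) {T : NestedTree ι} {p : List ι}
    (hr : T.IsRooted) (hp : T.GeneratesPlan Q p) (hnd : p.Nodup) {R P : ι}
    (hR : T.parent p R = some (P, false)) {pre rest : List ι} (hpre : p = pre ++ P :: rest) :
    (D.join {a | a ∈ pre ++ [P]}).ncard ≤ T.joinSizes D := by
  have hex : ∃ N, T.IsParentNode R N := by
    by_contra h
    simp [parent, h] at hR
  obtain ⟨N, hN, ⟨P', -, h⟩ | ⟨hna, h⟩⟩ := parent_cases (p := p) hex
  · simp [h] at hR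
  · obtain ⟨a, ha⟩ | ⟨q, s, h1, h2, h3, h4⟩ := hN.exists_prefix D hr hp
    · exact absurd ha (hna a)
    · have h5 := h q s h1 hnd h3
      rw [hR] at h5
      have h6 : q.getLast? = some P := by
        cases hq : q.getLast? <;> simp_all
      obtain ⟨q', rfl⟩ := List.getLast?_eq_some_iff.1 h6
      -- `P` occurs only once in the plan, so the segment before it is determined.
      have h7 : q' = pre := by
        have h8 : q' ++ P :: s = pre ++ P :: rest := by rw [← hpre, h1]; simp
        have hn : (q' ++ P :: s).Nodup := by rw [h8, ← hpre]; exact hnd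
        have hq' : P ∉ q' := fun hc => (List.nodup_append.1 hn).2.2 P hc P (by simp) rfl
        have hs : P ∉ s := (List.nodup_cons.1 (List.nodup_append.1 hn).2.1).1
        exact (List.append_cons_inj_of_notMem hq' hs).1 h8 |>.1
      subst h7
      refine le_trans ?_ h4
      cases N with
      | atom a => exact absurd rfl (hna a)
      | tree n G root node =>
        rw [joinSizes, ← h3]
        simp

end NestedTree

end TTJ

namespace TTJ

/-! ### Counting partial tuples by joins of plan prefixes -/

section Analysis

open Classical in
/-- The tuples of the relation of `R` that agree with `t` on the variables in `K`. -/
noncomputable def Database.matching {ι V α : Type*} [DecidableEq V] {Q : Query ι V} (D : Database Q α)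
    (R : ι) (K : Finset V) (t : Tup V α) : Finset (Tup V α) :=
  (D.rel R).toFinset.filter fun r => proj K r = proj K t

open Classical in
/-- An upper bound, regardless of deletions, for the number of outputs and of those loop iterations
at atoms in `F` that occur in a call of TTJ with tuple `t`. -/
noncomputable def extensionCount {ι V α : Type*} [DecidableEq ι] [DecidableEq V] {Q : Query ι V}
    (D : Database Q α) (F : Set ι) : List ι → List ι → Tup V α → ℕ
  | _, [], _ => 1
  | pre, R :: rest, t =>
      ∑ r ∈ D.matching R (keys Q.schema (pre ++ [R]) R) t,
        ((if R ∈ F then 1 else 0) + extensionCount D F (pre ++ [R]) rest (concat t r))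

variable {ι : Type*} {V : Type*} [DecidableEq V] {α : Type*}
  {Q : Query ι V} (D : Database Q α)

theorem Database.mem_matching {R : ι} {K : Finset V} {t r : Tup V α} :
    r ∈ D.matching R K t ↔ r ∈ D.rel R ∧ proj K r = proj K t := by
  simp [Database.matching]

theorem proj_concat_left {D : Database Q α} {pre : List ι} {t r : Tup V α}
    (ht : t ∈ D.join {a | a ∈ pre}) {a : ι} (ha : a ∈ pre) :
    proj (Q.schema a) (concat t r) = proj (Q.schema a) t := by
  funext x
  by_cases hx : x ∈ Q.schema a
  · obtain ⟨v, hv⟩ := Option.isSome_iff_exists.1 ((ht.1 x).2 ⟨a, ha, hx⟩)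
    simp [proj, concat, hx, hv]
  · simp [proj, hx]

variable [DecidableEq ι]

theorem mem_keys_append_singleton {sch : ι → Finset V} {pre : List ι} {R : ι} (hR : R ∉ pre)
    {x : V} : x ∈ keys sch (pre ++ [R]) R ↔ x ∈ sch R ∧ ∃ a ∈ pre, x ∈ sch a := by
  simp only [keys, Finset.mem_inter, Finset.mem_biUnion, Finset.mem_erase, List.mem_toFinset,
    List.mem_append, List.mem_singleton]
  refine and_congr_right fun _ => ⟨?_, ?_⟩
  · rintro ⟨a, ⟨hne, h | h⟩, hx⟩
    · exact ⟨a, h, hx⟩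
    · exact absurd h hne
  · rintro ⟨a, h, hx⟩
    exact ⟨a, ⟨fun he => hR (he ▸ h), .inl h⟩, hx⟩

section Concat

variable {D} {pre : List ι} {R : ι} {t r : Tup V α}

theorem proj_concat_right (hR : R ∉ pre) (ht : t ∈ D.join {a | a ∈ pre})
    (hr : r ∈ D.matching R (keys Q.schema (pre ++ [R]) R) t) :
    proj (Q.schema R) (concat t r) = r := by
  rw [D.mem_matching] at hr
  funext x
  by_cases hx : x ∈ Q.schema R
  · cases hv : t x with
    | none => simp [proj, concat, hx, hv]
    | some v =>
      have hk : x ∈ keys Q.schema (pre ++ [R]) R :=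
        (mem_keys_append_singleton hR).2 ⟨hx, (ht.1 x).1 (by simp [hv])⟩
      have := congrFun hr.2 x
      simp only [proj, if_pos hk] at this
      simp [proj, concat, hx, hv, this]
  · have := mt (D.dom R r hr.1 x).1 hx
    rw [Option.not_isSome_iff_eq_none] at this
    simp [proj, hx, this]

theorem concat_mem_join (hR : R ∉ pre) (ht : t ∈ D.join {a | a ∈ pre})
    (hr : r ∈ D.matching R (keys Q.schema (pre ++ [R]) R) t) :
    concat t r ∈ D.join {a | a ∈ pre ++ [R]} := by
  refine ⟨fun x => ?_, fun a ha => ?_⟩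
  · have h1 := ht.1 x
    have h2 := D.dom R r (D.mem_matching.1 hr).1 x
    have h3 : (concat t r x).isSome ↔ (t x).isSome ∨ (r x).isSome := by
      cases h : t x <;> simp [concat, h]
    rw [h3, h1, h2]
    simp [or_and_right, exists_or]
  · rcases List.mem_append.1 ha with h | h
    · rw [proj_concat_left ht h]
      exact ht.2 a h
    · rw [List.mem_singleton.1 h, proj_concat_right hR ht hr]
      exact (D.mem_matching.1 hr).1

/-- Both parts can be read off the concatenation: `r` is its projection to the schema of `R`, and
`t` its restriction to the variables of `pre`. -/
theorem concat_injective (hR : R ∉ pre) {t' r' : Tup V α} (ht : t ∈ D.join {a | a ∈ pre})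
    (hr : r ∈ D.matching R (keys Q.schema (pre ++ [R]) R) t) (ht' : t' ∈ D.join {a | a ∈ pre})
    (hr' : r' ∈ D.matching R (keys Q.schema (pre ++ [R]) R) t') (h : concat t r = concat t' r') :
    t = t' ∧ r = r' := by
  refine ⟨?_, by rw [← proj_concat_right hR ht hr, h, proj_concat_right hR ht' hr']⟩
  funext x
  by_cases hx : ∃ a ∈ pre, x ∈ Q.schema a
  · obtain ⟨a, ha, hxa⟩ := hx
    have h1 := proj_concat_left (r := r) ht ha
    rw [h, proj_concat_left ht' ha] at h1
    simpa [proj, hxa] using (congrFun h1 x).symm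
  · have h1 := mt (ht.1 x).1 hx
    have h2 := mt (ht'.1 x).1 hx
    rw [Option.not_isSome_iff_eq_none] at h1 h2
    rw [h1, h2]

end Concat

open Classical in
-- Summing over a set of partial tuples makes the induction work: by `concat_injective` the
-- extensions by one atom again form a set, inside the join of the longer prefix. Each position then
-- adds at most `J`, and the last level contributes the outputs.
theorem sum_extensionCount_le [Finite ι] (F : Set ι) (J : ℕ)
    (p : List ι) (hnd : p.Nodup)
    (hJ : ∀ pre R rest, p = pre ++ R :: rest → R ∈ F → (D.join {a | a ∈ pre ++ [R]}).ncard ≤ J)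
    (rest : List ι) : ∀ pre, p = pre ++ rest → ∀ S : Finset (Tup V α),
      (S : Set (Tup V α)) ⊆ D.join {a | a ∈ pre} →
      ∑ t ∈ S, extensionCount D F pre rest t ≤
        rest.length * J + (D.join {a | a ∈ p}).ncard := by
  induction rest with
  | nil =>
    intro pre hp S hS
    simp only [extensionCount, Finset.sum_const, smul_eq_mul, mul_one, List.length_nil, zero_mul,
      zero_add]
    rw [List.append_nil] at hp
    subst hp
    rw [← Set.ncard_coe_finset]
    exact Set.ncard_le_ncard hS (D.join_finite _)
  | cons R rest ih =>
    intro pre hp S hS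
    have hR : R ∉ pre := by
      rw [hp] at hnd
      exact fun h => (List.nodup_append.1 hnd).2.2 R h R (by simp) rfl
    have hp' : p = (pre ++ [R]) ++ rest := by simp [hp]
    let I := S.sigma fun t => D.matching R (keys Q.schema (pre ++ [R]) R) t
    let S' := I.image fun x => concat x.1 x.2
    have hS' : (S' : Set (Tup V α)) ⊆ D.join {a | a ∈ pre ++ [R]} := by
      intro u hu
      obtain ⟨⟨t, r⟩, hx, rfl⟩ := Finset.mem_image.1 hu
      obtain ⟨ht, hr⟩ := Finset.mem_sigma.1 hx
      exact concat_mem_join hR (hS ht) hr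
    have hinj : Set.InjOn (fun x : (_ : Tup V α) × Tup V α => concat x.1 x.2) I := by
      rintro ⟨t, r⟩ hx ⟨t', r'⟩ hx' h
      obtain ⟨ht, hr⟩ := Finset.mem_sigma.1 hx
      obtain ⟨ht', hr'⟩ := Finset.mem_sigma.1 hx'
      obtain ⟨h1, h2⟩ := concat_injective hR (hS ht) hr (hS ht') hr' h
      simp only at h1 h2
      subst h1 h2
      rfl
    have hsum : ∑ t ∈ S, extensionCount D F pre (R :: rest) t =
        ∑ u ∈ S', ((if R ∈ F then 1 else 0) + extensionCount D F (pre ++ [R]) rest u) := by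
      rw [Finset.sum_image hinj, Finset.sum_sigma]
      rfl
    have hcard : (∑ _u ∈ S', if R ∈ F then 1 else 0) ≤ J := by
      split_ifs with hF
      · rw [Finset.sum_const, smul_eq_mul, mul_one, ← Set.ncard_coe_finset]
        exact (Set.ncard_le_ncard hS' (D.join_finite _)).trans (hJ pre R rest hp hF)
      · simp
    have := ih (pre ++ [R]) hp' S' hS'
    rw [hsum, Finset.sum_add_distrib, List.length_cons, add_mul, one_mul]
    omega

theorem extensionCount_nil_le [Fintype ι] (F : Set ι) (J : ℕ) (p : List ι) (hp : IsPlan p)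
    (hJ : ∀ pre R rest, p = pre ++ R :: rest → R ∈ F →
      (D.join {a | a ∈ pre ++ [R]}).ncard ≤ J) :
    extensionCount D F [] p emptyTup ≤ p.length * J + D.outputSize := by
  have h := sum_extensionCount_le D F J p hp.1 hJ p [] rfl {emptyTup}
    (by simp [Database.join, emptyTup])
  rw [Finset.sum_singleton] at h
  convert h using 3
  rw [Database.outputSize]
  congr
  ext a
  simp [hp.2 a]

end Analysis

end TTJ

namespace TTJ

/-! ### Amortized cost of the recursion -/

section Cost

variable {ι : Type*} {V : Type*} {α : Type*}

theorem delete_tables_of_ne [DecidableEq ι] {σ : State ι V α} {R : ι} {k r : Tup V α} {R' : ι}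
    (h : R' ≠ R) : (σ.delete R k r).tables R' = σ.tables R' := by
  simp [State.delete, State.setBucket, h]

open Classical in
theorem delete_tables_self [DecidableEq ι] {σ : State ι V α} {R : ι} {k r : Tup V α}
    (k' : Tup V α) : (σ.delete R k r).tables R k' =
    if k' = k then (σ.tables R k).erase r else σ.tables R k' := by
  by_cases h : k' = k <;> simp [State.delete, State.setBucket, h]

variable [DecidableEq V] {Q : Query ι V}

/-- The buckets are duplicate-free, and the bucket of key `k` in the table of `R` consists of tuples
of `R` whose projection to the key schema `κ R` is `k`. -/
def Database.IsTables (D : Database Q α) (κ : ι → Finset V) (τ : ι → Tup V α → List (Tup V α)) :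
    Prop :=
  ∀ R k, (τ R k).Nodup ∧ ∀ r ∈ τ R k, r ∈ D.rel R ∧ proj (κ R) r = k

open Classical in
/-- The number of input tuples that have not been deleted from the tables. -/
noncomputable def Database.liveCount [Fintype ι] (D : Database Q α) (κ : ι → Finset V)
    (τ : ι → Tup V α → List (Tup V α)) : ℕ :=
  ∑ R, ((D.rel R).toFinset.filter fun r => r ∈ τ R (proj (κ R) r)).card

theorem Database.liveCount_le [Fintype ι] (D : Database Q α) (κ : ι → Finset V)
    (τ : ι → Tup V α → List (Tup V α)) : D.liveCount κ τ ≤ D.inputSize := by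
  classical
  refine Finset.sum_le_sum fun R _ => (Finset.card_filter_le _ _).trans ?_
  exact (List.toFinset_card_le _)

section Delete

variable [DecidableEq ι] {D : Database Q α} {κ : ι → Finset V} {σ : State ι V α} {R : ι}
  {k r : Tup V α}

theorem isTables_delete (h : D.IsTables κ σ.tables) : D.IsTables κ (σ.delete R k r).tables := by
  classical
  intro R' k'
  by_cases hR : R' = R
  · subst hR
    rw [delete_tables_self]
    split_ifs with hk
    · subst hk
      exact ⟨(h R' k').1.erase r, fun x hx => (h R' k').2 x (List.mem_of_mem_erase hx)⟩
    · exact h R' k'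
  · rw [delete_tables_of_ne hR]
    exact h R' k'

/-- A tuple lies only in the bucket of its own key, and there only once, so erasing it removes
exactly one live tuple. -/
theorem liveCount_delete [Fintype ι] (h : D.IsTables κ σ.tables) (hr : r ∈ σ.tables R k) :
    D.liveCount κ (σ.delete R k r).tables + 1 = D.liveCount κ σ.tables := by
  classical
  unfold Database.liveCount
  rw [← Finset.add_sum_erase _ _ (Finset.mem_univ R), ← Finset.add_sum_erase _ _ (Finset.mem_univ R)]
  have h1 : ∀ x ∈ Finset.univ.erase R,
      ((D.rel x).toFinset.filter fun y => y ∈ (σ.delete R k r).tables x (proj (κ x) y)).card =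
      ((D.rel x).toFinset.filter fun y => y ∈ σ.tables x (proj (κ x) y)).card := by
    intro x hx
    rw [delete_tables_of_ne (Finset.ne_of_mem_erase hx)]
  rw [Finset.sum_congr rfl h1]
  have hmem : r ∈ (D.rel R).toFinset.filter fun y => y ∈ σ.tables R (proj (κ R) y) := by
    obtain ⟨h2, h3⟩ := (h R k).2 r hr
    simp [h2, h3, hr]
  have h4 : ((D.rel R).toFinset.filter fun y => y ∈ (σ.delete R k r).tables R (proj (κ R) y)) =
      ((D.rel R).toFinset.filter fun y => y ∈ σ.tables R (proj (κ R) y)).erase r := by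
    ext y
    simp only [Finset.mem_filter, List.mem_toFinset, Finset.mem_erase, delete_tables_self]
    obtain ⟨-, h3⟩ := (h R k).2 r hr
    split_ifs with hk
    · rw [(h R k).1.mem_erase_iff, hk]
      tauto
    · have : y ≠ r := fun e => hk (e ▸ h3)
      tauto
  rw [h4, ← Finset.card_erase_add_one hmem]
  omega

end Delete

variable [DecidableEq ι]

/-- What a call of TTJ or a loop in it guarantees: only the tables of atoms in `touched` change, and,
up to the factor `K`, the steps are paid for by deletions, by the weight `w`, and by the possible
backjump, which together amount to at least `m`. -/
structure IsPaidFor [Fintype ι] (D : Database Q α) (κ : ι → Finset V)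
    (par : ι → Option (ι × Bool)) (touched : List ι) (K w m : ℕ) (σ : State ι V α)
    (out : Option (ι × Bool) × State ι V α) : Prop where
  isTables : D.IsTables κ out.2.tables
  frame : ∀ R ∉ touched, out.2.tables R = σ.tables R
  backjump : ∀ x, out.1 = some x → ∃ R, par R = some x
  progress : D.liveCount κ out.2.tables + m ≤
    D.liveCount κ σ.tables + w + out.1.toList.length
  cost : out.2.steps + K * D.liveCount κ out.2.tables ≤
    σ.steps + K * (D.liveCount κ σ.tables + w + out.1.toList.length)

variable [Fintype ι] {D : Database Q α} {κ : ι → Finset V} {par : ι → Option (ι × Bool)}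

/-- Each iteration costs at most two steps of its own, the iteration and a deletion. The unit of
progress guaranteed by the body covers them once `K` is raised by 2. The extra weight `f` per
iteration stands in for the deletion that a non-deleting backjump omits. -/
theorem loop_isPaidFor {R : ι} {k : Tup V α} {rest : List ι} (hR : R ∉ rest) {K : ℕ}
    {w : Tup V α → ℕ} {f : ℕ} (hf : ∀ R', par R' = some (R, false) → 1 ≤ f)
    {body : Tup V α → State ι V α → Option (ι × Bool) × State ι V α} (rs : List (Tup V α))
    (hbody : ∀ r ∈ rs, ∀ σ, D.IsTables κ σ.tables →
      IsPaidFor D κ par rest K (w r) 1 σ (body r σ)) :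
    ∀ σ : State ι V α, D.IsTables κ σ.tables → rs.Nodup → (∀ r ∈ rs, r ∈ σ.tables R k) →
      IsPaidFor D κ par (R :: rest) (K + 2) (rs.map fun r => f + w r).sum (min 1 rs.length) σ
        (loop R k body rs σ) := by
  classical
  induction rs with
  | nil =>
    intro σ hσ _ _
    exact ⟨hσ, fun _ _ => rfl, by simp [loop], by simp [loop], by simp [loop]⟩
  | cons r rs ih =>
    intro σ hσ hnd hmem
    have hb := hbody r (by simp) σ.tick hσ
    have ih' := ih fun r' h => hbody r' (by simp [h])
    have htick : σ.tick.tables = σ.tables := rfl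
    have hticks : σ.tick.steps = σ.steps + 1 := rfl
    obtain ⟨hnr, hnd'⟩ := List.nodup_cons.1 hnd
    rw [loop]
    obtain ⟨hb1, hb2, hb3, hb4, hb5⟩ := hb
    generalize body r σ.tick = out at hb1 hb2 hb3 hb4 hb5
    rw [htick] at hb4 hb5
    rw [hticks] at hb5
    have hsame := hb2 R hR
    rw [htick] at hsame
    have hmin : min 1 (r :: rs).length = 1 := by simp
    rw [hmin, List.map_cons, List.sum_cons]
    match out with
    | (none, σ') =>
      simp only [Option.toList_none, List.length_nil, add_zero] at *
      obtain ⟨h1, h2, h3, h4, h5⟩ := ih' σ' hb1 hnd'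
        (fun x hx => by rw [hsame]; exact hmem x (by simp [hx]))
      refine ⟨h1, fun R' hR' => ?_, h3, by omega, ?_⟩
      · rw [h2 R' hR', hb2 R' (by simp_all)]
        rfl
      · have : 0 ≤ (K + 2) * f := Nat.zero_le _
        linarith
    | (some (P, d), σ') =>
      simp only [Option.toList_some, List.length_singleton] at *
      split_ifs with hP hd
      · subst hP hd
        have hr : r ∈ σ'.tables P k := by rw [hsame]; exact hmem r (by simp)
        -- The deleted tuple is worth `K + 2`: `K` cancels the token of the caught backjump, and 2
        -- pays for the iteration and the deletion.
        have hdel := liveCount_delete hb1 hr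
        have hdel' : (σ'.delete P k r).steps = σ'.steps + 1 := rfl
        obtain ⟨h1, h2, h3, h4, h5⟩ := ih' (σ'.delete P k r) (isTables_delete hb1) hnd' (by
          intro x hx
          rw [delete_tables_self, if_pos rfl, hsame, (hσ P k).1.mem_erase_iff]
          exact ⟨fun e => hnr (e ▸ hx), hmem x (by simp [hx])⟩)
        refine ⟨h1, fun R' hR' => ?_, h3, by omega, ?_⟩
        · rw [h2 R' hR', delete_tables_of_ne (by simp_all), hb2 R' (by simp_all)]
          rfl
        · have : 0 ≤ (K + 2) * f := Nat.zero_le _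
          rw [← hdel] at hb4 hb5
          rw [hdel'] at h5
          linarith
      · subst hP
        -- The backjump is the `par` entry of some atom, with flag `false`, so `hf` gives `f ≥ 1`;
        -- this unit redeems the token in place of a deletion.
        obtain ⟨R₀, hR₀⟩ := hb3 _ rfl
        have hf1 := hf R₀ (by simpa [hd] using hR₀)
        obtain ⟨h1, h2, h3, h4, h5⟩ := ih' σ' hb1 hnd'
          (fun x hx => by rw [hsame]; exact hmem x (by simp [hx]))
        refine ⟨h1, fun R' hR' => ?_, h3, by omega, ?_⟩
        · rw [h2 R' hR', hb2 R' (by simp_all)]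
          rfl
        · have := Nat.mul_le_mul_left (K + 2) hf1
          linarith
      -- The token is handed on as the result of the loop; the weight of the remaining tuples is
      -- given up.
      · refine ⟨hb1, fun R' hR' => by rw [hb2 R' (by simp_all)]; rfl, hb3, ?_, ?_⟩
        · simp only [Option.toList_some, List.length_singleton]
          omega
        · simp only [Option.toList_some, List.length_singleton]
          have : 0 ≤ (K + 2) * (f + (rs.map fun r => f + w r).sum) := Nat.zero_le _
          linarith

/-- The loop of a call, together with the step for the call. -/
theorem call_isPaidFor {F : Set ι} (hF : ∀ R P, par R = some (P, false) → P ∈ F)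
    {pre rest : List ι} {R : ι} (hR : R ∉ rest) (hκ : keys Q.schema (pre ++ [R]) R = κ R)
    {K : ℕ} (t : Tup V α) {σ : State ι V α} (hσ : D.IsTables κ σ.tables)
    (hbody : ∀ r σ', D.IsTables κ σ'.tables → IsPaidFor D κ par rest K
      (extensionCount D F (pre ++ [R]) rest (concat t r)) 1 σ'
      (ttj Q par (pre ++ [R]) rest (concat t r) σ')) :
    IsPaidFor D κ par (R :: rest) (K + 2) (extensionCount D F pre (R :: rest) t)
      (min 1 (σ.tables R (proj (κ R) t)).length) σ.tick
      (loop R (proj (κ R) t) (fun r σ' => ttj Q par (pre ++ [R]) rest (concat t r) σ')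
        (σ.tables R (proj (κ R) t)) σ.tick) := by
  classical
  have h := loop_isPaidFor (k := proj (κ R) t) hR (f := if R ∈ F then 1 else 0)
    (fun R' h => by rw [if_pos (hF R' R h)]) (σ.tables R (proj (κ R) t))
    (fun r _ => hbody r) σ.tick hσ (hσ R _).1 (fun r hr => hr)
  have hle : ((σ.tables R (proj (κ R) t)).map fun r => (if R ∈ F then 1 else 0) +
      extensionCount D F (pre ++ [R]) rest (concat t r)).sum ≤
      extensionCount D F pre (R :: rest) t := by
    rw [extensionCount, ← List.sum_toFinset _ (hσ R _).1]
    refine Finset.sum_le_sum_of_subset fun r hr => ?_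
    rw [D.mem_matching, hκ]
    exact (hσ R _).2 r (List.mem_toFinset.1 hr)
  obtain ⟨h1, h2, h3, h4, h5⟩ := h
  refine ⟨h1, h2, h3, h4.trans (by gcongr), h5.trans ?_⟩
  gcongr

/-- The factor grows by 3 per atom: 2 for the loop and 1 for the call. An empty bucket makes
progress only through its backjump, which is why every atom of `rest` needs a parent. -/
theorem ttj_isPaidFor {F : Set ι} (hF : ∀ R P, par R = some (P, false) → P ∈ F)
    {p : List ι} (hnd : p.Nodup)
    (hκ : ∀ pre R rest, p = pre ++ R :: rest → keys Q.schema (pre ++ [R]) R = κ R)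
    (rest : List ι) (hpar : ∀ R ∈ rest, par R ≠ none) :
    ∀ pre, p = pre ++ rest → ∀ (t : Tup V α) (σ : State ι V α), D.IsTables κ σ.tables →
      IsPaidFor D κ par rest (3 * rest.length + 1) (extensionCount D F pre rest t) 1 σ
        (ttj Q par pre rest t σ) := by
  induction rest with
  | nil =>
    intro pre hp t σ hσ
    exact ⟨hσ, fun _ _ => rfl, by simp [ttj], by simp [ttj, extensionCount, State.emit],
      by simp [ttj, extensionCount, State.emit]; omega⟩
  | cons R rest ih =>
    intro pre hp t σ hσ
    have hR : R ∉ rest := (List.nodup_cons.1 (List.nodup_append.1 (hp ▸ hnd)).2.1).1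
    have hk := hκ pre R rest hp
    have hc := call_isPaidFor hF hR hk t hσ fun r σ' =>
      ih (fun R' h => hpar R' (by simp [h])) (pre ++ [R]) (by simp [hp]) (concat t r) σ'
    obtain ⟨P, hP⟩ := Option.ne_none_iff_exists'.1 (hpar R (by simp))
    rw [ttj]
    simp only [hk, hP]
    cases hb : σ.tables R (proj (κ R) t) with
    | nil =>
      refine ⟨hσ, fun _ _ => rfl, ?_, ?_, ?_⟩
      · rintro x hx
        exact ⟨R, hP.trans hx⟩
      · simp [State.tick]
      · simp only [State.tick, Option.toList_some, List.length_cons, List.length_nil]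
        have : 0 ≤ (3 * (rest.length + 1) + 1) * extensionCount D F pre (R :: rest) t :=
          Nat.zero_le _
        linarith
    | cons r rs =>
      rw [hb] at hc
      obtain ⟨h1, h2, h3, h4, h5⟩ := hc
      have hmin : min 1 (r :: rs).length = 1 := by simp
      have htick : σ.tick.tables = σ.tables := rfl
      have hticks : σ.tick.steps = σ.steps + 1 := rfl
      rw [hmin] at h4
      rw [htick] at h4 h5
      rw [hticks] at h5
      refine ⟨h1, h2, h3, h4, ?_⟩
      rw [List.length_cons]
      linarith

/-- The first atom may lack a parent, and its call may then make no progress. It is called only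
once, so its step is absorbed by the final `+ 1`. -/
theorem ttj_steps_le {F : Set ι} (hF : ∀ R P, par R = some (P, false) → P ∈ F)
    {p : List ι} (hnd : p.Nodup)
    (hκ : ∀ pre R rest, p = pre ++ R :: rest → keys Q.schema (pre ++ [R]) R = κ R)
    (hpar : ∀ R ∈ p.tail, par R ≠ none) (t : Tup V α) {σ : State ι V α}
    (hσ : D.IsTables κ σ.tables) :
    (ttj Q par [] p t σ).2.steps ≤
      σ.steps + (3 * p.length + 1) * (D.liveCount κ σ.tables + extensionCount D F [] p t + 1) := by
  have main : ∀ {m : ℕ} {out : Option (ι × Bool) × State ι V α} {K w : ℕ} {σ : State ι V α},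
      IsPaidFor D κ par p K w m σ out →
      out.2.steps ≤ σ.steps + K * (D.liveCount κ σ.tables + w + 1) := by
    intro m out K w σ h
    have h1 : out.1.toList.length ≤ 1 := by cases out.1 <;> simp
    exact (Nat.le_add_right _ _).trans (h.cost.trans (by gcongr))
  cases p with
  | nil => exact main (ttj_isPaidFor hF hnd hκ [] (by simp) [] rfl t σ hσ)
  | cons R rest =>
    cases hR : par R with
    | some P =>
      refine main (ttj_isPaidFor hF hnd hκ (R :: rest) ?_ [] rfl t σ hσ)
      intro R' h
      rcases List.mem_cons.1 h with rfl | h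
      · simp [hR]
      · exact hpar R' h
    | none =>
      have hk := hκ [] R rest rfl
      have hc := call_isPaidFor hF (List.nodup_cons.1 hnd).1 hk t hσ fun r σ' =>
        ttj_isPaidFor hF hnd hκ rest hpar ([] ++ [R]) rfl (concat t r) σ'
      have h := main hc
      have htick : σ.tick.tables = σ.tables := rfl
      have hticks : σ.tick.steps = σ.steps + 1 := rfl
      rw [htick, hticks] at h
      have hle : (loop R (proj (κ R) t) (fun r σ' => ttj Q par ([] ++ [R]) rest (concat t r) σ')
          (σ.tables R (proj (κ R) t)) σ.tick).2.steps ≤ σ.steps + (3 * (R :: rest).length + 1) *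
            (D.liveCount κ σ.tables + extensionCount D F [] (R :: rest) t + 1) := by
        refine h.trans ?_
        rw [List.length_cons]
        have : 0 ≤ D.liveCount κ σ.tables + extensionCount D F [] (R :: rest) t := Nat.zero_le _
        linarith
      rw [ttj]
      simp only [hk, hR]
      rcases hb : σ.tables R (proj (κ R) t) with _ | ⟨r, rs⟩ <;> rw [hb] at hle <;> exact hle

end Cost

end TTJ

namespace TTJ

/-! ### Building the tables, and the total bound -/

section Build

variable {ι : Type*} {V : Type*} [DecidableEq ι] [DecidableEq V] {α : Type*} {Q : Query ι V}
  {D : Database Q α} {κ : ι → Finset V}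

theorem isTables_foldl_insert {R : ι} (l : List (Tup V α)) (hnd : l.Nodup)
    (hl : ∀ r ∈ l, r ∈ D.rel R) : ∀ σ : State ι V α, D.IsTables κ σ.tables →
      (∀ r ∈ l, ∀ k, r ∉ σ.tables R k) →
      let σ' := l.foldl (fun σ r => σ.insert R (proj (κ R) r) r) σ
      D.IsTables κ σ'.tables ∧ (∀ R', R' ≠ R → σ'.tables R' = σ.tables R') ∧
        σ'.steps = σ.steps + l.length := by
  classical
  induction l with
  | nil => exact fun σ hσ _ => ⟨hσ, fun _ _ => rfl, rfl⟩
  | cons r l ih =>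
    intro σ hσ hnot
    obtain ⟨hr, hnd⟩ := List.nodup_cons.1 hnd
    have hself : ∀ k, (σ.insert R (proj (κ R) r) r).tables R k =
        if k = proj (κ R) r then r :: σ.tables R k else σ.tables R k := by
      intro k
      by_cases h : k = proj (κ R) r <;> simp [State.insert, State.setBucket, h]
    have hne : ∀ R', R' ≠ R →
        (σ.insert R (proj (κ R) r) r).tables R' = σ.tables R' := by
      intro R' h
      simp [State.insert, State.setBucket, h]
    have hins : D.IsTables κ (σ.insert R (proj (κ R) r) r).tables := by
      intro R' k
      by_cases hR : R' = R
      · subst hR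
        rw [hself]
        split_ifs with hk
        · refine ⟨List.nodup_cons.2 ⟨hnot r (by simp) k, (hσ R' k).1⟩, fun x hx => ?_⟩
          rcases List.mem_cons.1 hx with rfl | hx
          · exact ⟨hl x (by simp), hk.symm⟩
          · exact (hσ R' k).2 x hx
        · exact hσ R' k
      · rw [hne R' hR]
        exact hσ R' k
    obtain ⟨h1, h2, h3⟩ := ih hnd (fun x hx => hl x (by simp [hx])) _ hins (by
      intro x hx k
      rw [hself]
      have hx' := hnot x (by simp [hx]) k
      split_ifs
      · exact fun h => (List.mem_cons.1 h).elim (fun e => hr (e ▸ hx)) hx'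
      · exact hx')
    refine ⟨h1, fun R' hR' => (h2 R' hR').trans (hne R' hR'), h3.trans ?_⟩
    simp only [State.insert, State.setBucket, List.length_cons]
    omega

theorem isTables_buildTables {p : List ι} (hnd : p.Nodup)
    (hκ : ∀ pre R rest, p = pre ++ R :: rest → keys Q.schema (pre ++ [R]) R = κ R)
    (rest : List ι) : ∀ (pre : List ι) (σ : State ι V α), p = pre ++ rest →
      D.IsTables κ σ.tables → (∀ R ∈ rest, ∀ k, σ.tables R k = []) →
      D.IsTables κ (buildTables D pre rest σ).tables ∧
        (buildTables D pre rest σ).steps =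
          σ.steps + (rest.map fun R => (D.rel R).length).sum := by
  induction rest with
  | nil => exact fun pre σ _ hσ _ => ⟨hσ, rfl⟩
  | cons R rest ih =>
    intro pre σ hp hσ hempty
    have hR : R ∉ rest := (List.nodup_cons.1 (List.nodup_append.1 (hp ▸ hnd)).2.1).1
    rw [buildTables, hκ pre R rest hp]
    obtain ⟨h1, h2, h3⟩ := isTables_foldl_insert (κ := κ) (D.rel R) (D.nodup R) (fun _ h => h) σ hσ
      (by simp [hempty R (by simp)])
    obtain ⟨h4, h5⟩ := ih (pre ++ [R]) _ (by simp [hp]) h1 (by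
      intro R' hR' k
      rw [h2 R' (fun e => hR (e ▸ hR'))]
      exact hempty R' (by simp [hR']) k)
    refine ⟨h4, h5.trans ?_⟩
    rw [h3, List.map_cons, List.sum_cons, add_assoc]

theorem exists_keys_eq (sch : ι → Finset V) {p : List ι} (hnd : p.Nodup) :
    ∃ κ : ι → Finset V, ∀ pre R rest, p = pre ++ R :: rest → keys sch (pre ++ [R]) R = κ R := by
  -- Without repetitions, the atoms before `R` depend on `R` alone, so its key schema is a function
  -- of `R`.
  refine ⟨fun R => keys sch (p.takeWhile (· ≠ R) ++ [R]) R, ?_⟩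
  rintro pre R rest rfl
  have hR : R ∉ pre := fun h => (List.nodup_append.1 hnd).2.2 R h R (by simp) rfl
  have : (pre ++ R :: rest).takeWhile (· ≠ R) = pre := by
    rw [List.takeWhile_append_of_pos, List.takeWhile_cons_of_neg (by simp), List.append_nil]
    intro a ha
    simpa using fun e : a = R => hR (e ▸ ha)
  simp only [this]

/-- If the joins of the initial segments of the plan that end in an atom to which backjumps without
deletion occur have at most `J` tuples, then TTJ runs in time `O(|IN| + |OUT| + J)`. -/
theorem run_steps_le [Fintype ι] {p : List ι} (hp : IsPlan p) {par : ι → Option (ι × Bool)}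
    (hpar : ∀ R ∈ p.tail, par R ≠ none) (J : ℕ)
    (hJ : ∀ R P pre rest, par R = some (P, false) → p = pre ++ P :: rest →
      (D.join {a | a ∈ pre ++ [P]}).ncard ≤ J) :
    (run D par p).steps ≤ D.inputSize +
      (3 * p.length + 1) * (D.inputSize + (p.length * J + D.outputSize) + 1) := by
  obtain ⟨κ, hκ⟩ := exists_keys_eq Q.schema hp.1
  obtain ⟨h1, h2⟩ := isTables_buildTables (D := D) hp.1 hκ p [] ⟨fun _ _ => [], [], 0⟩ rfl
    (by simp [Database.IsTables]) (by simp)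
  have h3 := ttj_steps_le (F := {P | ∃ R, par R = some (P, false)}) (fun R P h => ⟨R, h⟩) hp.1 hκ
    hpar emptyTup h1
  have h4 := extensionCount_nil_le D {P | ∃ R, par R = some (P, false)} J p hp
    fun pre P rest h ⟨R, hR⟩ => hJ R P pre rest hR h
  have h5 := D.liveCount_le κ (buildTables D [] p ⟨fun _ _ => [], [], 0⟩).tables
  have h6 : (p.map fun R => (D.rel R).length).sum = D.inputSize := by
    rw [Database.inputSize, ← List.sum_toFinset _ hp.1]
    congr
    ext a
    simp [hp.2 a]
  rw [h2, h6, zero_add] at h3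
  exact h3.trans (by gcongr)

end Build

end TTJ

theorem mainTheorem5 {ι : Type u} {V : Type v} [Fintype ι] [DecidableEq ι] [DecidableEq V]
    (Q : TTJ.Query ι V) (T : TTJ.NestedTree ι)
    (hT : T.IsTreeConvolution Q) (hroot : T.IsRooted) :
    ∃ p : List ι, TTJ.IsPlan p ∧ T.GeneratesPlan Q p ∧
      ∃ C : ℕ, ∀ (α : Type w) (D : TTJ.Database Q α),
        (TTJ.run D (T.parent p) p).steps ≤
          C * (1 + D.inputSize + D.outputSize + T.joinSizes D) := by
  obtain ⟨p, hp⟩ := TTJ.NestedTree.IsNestedJoinTree.exists_generatesPlan (.inr hT.1) hroot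
  have hatoms : (p : Multiset ι) = Finset.univ.val := hp.coe_eq_atoms.trans hT.2
  have hplan : TTJ.IsPlan p := by
    refine ⟨?_, fun a => ?_⟩
    · rw [← Multiset.coe_nodup, hatoms]
      exact Finset.univ.nodup
    · rw [← Multiset.mem_coe, hatoms]
      exact Finset.mem_univ a
  -- The factor `p.length + 1` absorbs the `p.length` copies of `joinSizes`; the last `+ 1` pays for
  -- building the tables.
  refine ⟨p, hplan, hp, (3 * p.length + 1) * (p.length + 1) + 1, fun α D => ?_⟩
  refine (TTJ.run_steps_le hplan (fun R => hp.parent_ne_none hT.1 hroot hplan.1)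
    (T.joinSizes D) fun R P pre rest h => hp.ncard_join_le D hroot hplan.1 h).trans ?_
  have h1 : D.inputSize + (p.length * T.joinSizes D + D.outputSize) + 1 ≤
      (p.length + 1) * (1 + D.inputSize + D.outputSize + T.joinSizes D) := by
    have : 0 ≤ p.length * (1 + D.inputSize + D.outputSize) := Nat.zero_le _
    linarith
  have h2 := Nat.mul_le_mul_left (3 * p.length + 1) h1
  linarith
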